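/- Let $E$ be a finite-dimensional real inner product space (e.g. $\mathbb R^D$ with the dot product). A finite set $\Omega$ of pairs $\langle\alpha_i,c_i\rangle\in E\times\mathbb R$, $i\in I$, represents the system of linear constraints $\alpha_i\cdot b\ge c_i$; write $$\mathrm{sat}(\Omega)=\{b\in E:\ \alpha_i\cdot b\ge c_i\ \text{for all } i\in I\},\qquad \mathrm{reg}_c(\Omega)=\Big\{\sum_{i\in I}\lambda_i\alpha_i:\ \lambda_i\ge 0,\ \sum_{i\in I}\lambda_i c_i\ge c\Big\}.$$ A constraint $\langle\alpha,c\rangle$ supports a point $b$ if $\alpha\neq 0$ and $\alpha\cdot b=c$. A minimal representation of a set $X\subseteq E$ is a finite system $L$ of constraints with $\mathrm{sat}(L)=X$ that has the smallest possible number of elements. Let $\Omega$ be such a system with all $c_i\in\{1,0,-1\}$ and $\mathrm{sat}(\Omega)\ne\emptyset$, and put $I_c=\{i: c_i=c\}$. Facet systems $\mho_\pm$ of $\Omega$ are obtained as follows. First adjoin the trivial constraint $\langle 0,-1\rangle$ to $\Omega$ and delete $\langle 0,0\rangle$ if it is present; in the next formulas $I_c$ refers to the system so modified. Choose an integer $p>1$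 (possibly different for the two signs), and for each sign let $H^{(p)}_\pm$ be the convex hull of $P_\pm\cup Z^{(p)}_\pm\cup N^{(p)}_\pm$, where $$P_\pm=\{\alpha_i: i\in I_{\pm1}\},\quad Z^{(p)}_\pm=\{\alpha_i+(p-1)\alpha_j: i\in I_{\pm1},\,j\in I_0\},\quad N^{(p)}_\pm=\{p\alpha_i+(p-1)\alpha_j: i\in I_{\pm1},\,j\in I_{\mp1}\}.$$ Choose a minimal representation $\{\langle n_\ell,r_\ell\rangle\}_{\ell\in L_\pm}$ of $H^{(p)}_\pm$, and let $\mho_\pm$ consist of those $\langle n_\ell,r_\ell\rangle$ that support at least one point of $P_\pm$. Then, for all choices made in the construction: 1. If $I_1\neq\emptyset$, then $\mathrm{sat}(\mho_+)=\mathrm{reg}_1(\Omega)$, $\mathrm{sat}(\mho_-)=\mathrm{reg}_{-1}(\Omega)$ and $\mathrm{sat}(\Omega)=\mathrm{reg}_1(\mho_+)\cap\mathrm{reg}_{-1}(\mho_-)$. 2. If $I_1=\emptyset$, then $\mathrm{sat}(\mho_-)=\mathrm{reg}_{-1}(\Omega)$ and $\mathrm{sat}(\Omega)=\mathrm{reg}_{-1}(\mho_-)$.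 -/

import Mathlib

open scoped RealInnerProductSpace

namespace LinearConstraints

section

variable {E : Type*} [NormedAddCommGroup E] [InnerProductSpace ℝ E]

/-- A finite combination of linear constraints is a finite set `Ω` of pairs `(α, c)`, each pair
standing for the inequality `⟪α, b⟫ ≥ c`. This is the set of points satisfying all of them. -/
def sat (Ω : Finset (E × ℝ)) : Set E :=
  {b | ∀ x ∈ Ω, x.2 ≤ ⟪x.1, b⟫}

/-- The region `reg_c(Ω)`: all combinations `∑ λᵢ αᵢ` with `λᵢ ≥ 0` and `∑ λᵢ cᵢ ≥ c`. -/
def reg (c : ℝ) (Ω : Finset (E × ℝ)) : Set E :=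
  {β | ∃ w : E × ℝ → ℝ, (∀ x ∈ Ω, 0 ≤ w x) ∧ c ≤ ∑ x ∈ Ω, w x * x.2 ∧
    β = ∑ x ∈ Ω, w x • x.1}

/-- A linear constraint `(α, c)` supports a point `b` if `α ≠ 0` and `⟪α, b⟫ = c`. -/
def Supports (x : E × ℝ) (b : E) : Prop :=
  x.1 ≠ 0 ∧ ⟪x.1, b⟫ = x.2

/-- `L` describes the set `X`, with the smallest possible number of linear constraints. -/
def IsMinimalRepresentation (L : Finset (E × ℝ)) (X : Set E) : Prop :=
  sat L = X ∧ ∀ L' : Finset (E × ℝ), sat L' = X → L.card ≤ L'.card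

open scoped Classical in
/-- The normalised form of `Ω` used in the construction: the trivial constraint `(0, -1)` is
adjoined and the trivial constraint `(0, 0)` is left out, neither of which changes `sat Ω`. -/
noncomputable def normalise (Ω : Finset (E × ℝ)) : Finset (E × ℝ) :=
  insert (0, -1) (Ω.filter (fun x => x ≠ (0, 0)))

/-- The points `αᵢ` with `cᵢ = s`; here and below `s` is `1` or `-1`. -/
def pointsP (s : ℝ) (Ω : Finset (E × ℝ)) : Set E :=
  {v | (v, s) ∈ Ω}

/-- The points `αᵢ + (p - 1) αⱼ` with `cᵢ = s` and `cⱼ = 0`. -/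
def pointsZ (s : ℝ) (p : ℕ) (Ω : Finset (E × ℝ)) : Set E :=
  {v | ∃ α β : E, (α, s) ∈ Ω ∧ (β, (0 : ℝ)) ∈ Ω ∧ v = α + ((p : ℝ) - 1) • β}

/-- The points `p αᵢ + (p - 1) αⱼ` with `cᵢ = s` and `cⱼ = -s`. -/
def pointsN (s : ℝ) (p : ℕ) (Ω : Finset (E × ℝ)) : Set E :=
  {v | ∃ α β : E, (α, s) ∈ Ω ∧ (β, -s) ∈ Ω ∧ v = (p : ℝ) • α + ((p : ℝ) - 1) • β}

/-- The polytope spanned by the three sets of points. -/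
def hullH (s : ℝ) (p : ℕ) (Ω : Finset (E × ℝ)) : Set E :=
  convexHull ℝ (pointsP s Ω ∪ pointsZ s p Ω ∪ pointsN s p Ω)

open scoped Classical in
/-- The members of `L` that support at least one of the points `αᵢ` with `cᵢ = s`. -/
noncomputable def supportingPart (s : ℝ) (Ω L : Finset (E × ℝ)) : Finset (E × ℝ) :=
  L.filter (fun x => ∃ v ∈ pointsP s Ω, Supports x v)

/-- `U` is a facet system of `Ω` for the sign `s` and the integer `p`: it consists of those
constraints, in some minimal representation of the polytope `hullH`, that support a point of
`pointsP`. For `s = 1` and `s = -1` these are the systems `℧₊` and `℧₋`. -/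
def IsFacetSystem (s : ℝ) (p : ℕ) (Ω U : Finset (E × ℝ)) : Prop :=
  ∃ L : Finset (E × ℝ), IsMinimalRepresentation L (hullH s p (normalise Ω)) ∧
    U = supportingPart s (normalise Ω) L

end

end LinearConstraints

/-! The core identity is `sat U = reg s Ω` for a facet system `U` of sign `s`. If a facet inequality
`(n, r)` is tight at some `v` in P, validity at the Z and N points built from `v` forces `⟪n, α⟫ ≥ s
* r * c` for every `(α, c)` in Ω; as `s * r ≥ 0`, nonnegative combinations give `reg_subset_sat`.
Conversely, a functional compatible with Ω attains its minimum over the polytope at a point of P,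
and `sat U` lies in the tangent cone there, so Farkas gives `sat_subset_reg`. Applying affine Farkas
(`mem_reg_iff`) to `U` then makes its region a polar of `reg s Ω`, and suitable multiples of the `α`
recover the constraints of Ω. -/

/-- **Farkas' lemma** for a finite family of linear functionals: a functional which is nonnegative
wherever all members of the family are is a nonnegative combination of them. -/
theorem exists_nonneg_sum_smul_eq_of_forall {ι V : Type*} [AddCommGroup V] [Module ℝ V]
    (S : Finset ι) (a : ι → V →ₗ[ℝ] ℝ) (f : V →ₗ[ℝ] ℝ)
    (h : ∀ x, (∀ i ∈ S, 0 ≤ a i x) → 0 ≤ f x) :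
    ∃ w : ι → ℝ, (∀ i, 0 ≤ w i) ∧ f = ∑ i ∈ S, w i • a i := by
  classical
  induction S using Finset.induction_on generalizing a f with
  | empty =>
    refine ⟨0, fun _ => le_rfl, LinearMap.ext fun x => ?_⟩
    have h₁ := h x (by simp)
    have h₂ := h (-x) (by simp)
    rw [map_neg] at h₂
    simpa using le_antisymm (by linarith) h₁
  | insert j S hj ih =>
    by_cases hS : ∀ x, (∀ i ∈ S, 0 ≤ a i x) → 0 ≤ f x
    · obtain ⟨w, hw, rfl⟩ := ih a f hS
      refine ⟨fun i => if i = j then 0 else w i, fun i => ?_, ?_⟩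
      · dsimp only
        split_ifs
        exacts [le_rfl, hw i]
      · simp only [Finset.sum_insert hj, if_true, zero_smul, zero_add]
        exact Finset.sum_congr rfl fun i hi => by rw [if_neg (ne_of_mem_of_not_mem hi hj)]
    · push Not at hS
      obtain ⟨u, hu, hfu⟩ := hS
      have hju : a j u < 0 := by
        by_contra! hcon
        exact absurd (h u (Finset.forall_mem_insert _ _ _ |>.2 ⟨hcon, hu⟩)) (not_le.2 hfu)
      -- rescale so that `a j` takes the value `-1`
      obtain ⟨z, hz, hfz, hjz⟩ : ∃ z, (∀ i ∈ S, 0 ≤ a i z) ∧ f z < 0 ∧ a j z = -1 := by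
        have hpos : 0 < (-a j u)⁻¹ := inv_pos.2 (by linarith)
        refine ⟨(-a j u)⁻¹ • u, fun i hi => ?_, ?_, ?_⟩
        · rw [map_smul, smul_eq_mul]
          exact mul_nonneg hpos.le (hu i hi)
        · rw [map_smul, smul_eq_mul]
          exact mul_neg_of_pos_of_neg hpos hfu
        · rw [map_smul, smul_eq_mul]
          rw [inv_neg, neg_mul, inv_mul_cancel₀ hju.ne]
      -- Since `a j z = -1`, the map `x ↦ x + a j x • z` projects onto the kernel of `a j`; these
      -- are the functionals composed with it.
      obtain ⟨w, hw, hfw⟩ := ih (fun i => a i + a i z • a j) (f + f z • a j) (by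
        intro x hx
        have := h (x + a j x • z) (Finset.forall_mem_insert _ _ _ |>.2 ⟨?_, fun i hi => ?_⟩)
        · simpa [mul_comm] using this
        · simp [hjz]
        · simpa [mul_comm] using hx i hi)
      refine ⟨fun i => if i = j then (∑ k ∈ S, w k * a k z) - f z else w i, fun i => ?_, ?_⟩
      · dsimp only
        split_ifs
        · have : 0 ≤ ∑ k ∈ S, w k * a k z :=
            Finset.sum_nonneg fun k hk => mul_nonneg (hw k) (hz k hk)
          linarith
        · exact hw i
      · have hrest : ∑ i ∈ S, (if i = j then (∑ k ∈ S, w k * a k z) - f z else w i) • a i =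
            ∑ i ∈ S, w i • a i :=
          Finset.sum_congr rfl fun i hi => by rw [if_neg (ne_of_mem_of_not_mem hi hj)]
        simp only [Finset.sum_insert hj, if_true, hrest]
        refine (eq_sub_of_add_eq hfw).trans ?_
        simp only [smul_add, Finset.sum_add_distrib, smul_smul, ← Finset.sum_smul]
        module

namespace LinearConstraints

variable {E : Type*} [NormedAddCommGroup E] [InnerProductSpace ℝ E]

/-! ### Affine Farkas lemmas -/

/-- Homogenised affine Farkas lemma: a constraint implied by all rescalings of `U` lies in the
corresponding region. -/
theorem mem_reg_of_forall {U : Finset (E × ℝ)} {s : ℝ} {b : E}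
    (h : ∀ (y : E) (τ : ℝ), 0 ≤ τ → (∀ x ∈ U, τ * x.2 ≤ ⟪x.1, y⟫) → τ * s ≤ ⟪b, y⟫) :
    b ∈ reg s U := by
  let g : E × ℝ → (E × ℝ) →ₗ[ℝ] ℝ := fun x =>
    (innerₗ E x.1).comp (LinearMap.fst ℝ E ℝ) - x.2 • LinearMap.snd ℝ E ℝ
  have hg : ∀ x y : E × ℝ, g x y = ⟪x.1, y.1⟫ - x.2 * y.2 := fun x y => by simp [g]
  -- The index `none` carries the condition `0 ≤ τ`; its weight becomes the slack in `s ≤ ∑ w x *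
  -- x.2`.
  obtain ⟨w, hw, hsum⟩ := exists_nonneg_sum_smul_eq_of_forall (Finset.insertNone U)
    (fun o => o.elim (LinearMap.snd ℝ E ℝ) g) (g (b, s)) (by
      rintro ⟨y, τ⟩ hy
      have h₁ := h y τ (by simpa using hy none (by simp)) (fun x hx => by
        have := hy (some x) (by simpa using hx)
        simp only [Option.elim, hg] at this
        linarith)
      rw [hg]
      dsimp only
      linarith)
  rw [Finset.sum_insertNone] at hsum
  have hval := fun y => DFunLike.congr_fun hsum y
  simp only [Option.elim, hg, LinearMap.add_apply, LinearMap.smul_apply, LinearMap.snd_apply,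
    LinearMap.sum_apply, smul_eq_mul] at hval
  refine ⟨fun x => w (some x), fun x _ => hw _, ?_, ?_⟩
  · have h₁ := hval (0, 1)
    simp only [inner_zero_right, mul_one, zero_sub, mul_neg, Finset.sum_neg_distrib] at h₁
    linarith [hw none]
  · refine ext_inner_right ℝ fun y => ?_
    have h₁ := hval (y, 0)
    simp only [mul_zero, sub_zero, zero_add] at h₁
    simp only [h₁, sum_inner, inner_smul_left, RCLike.conj_to_real]

/-- The affine Farkas lemma for a feasible system. -/
theorem mem_reg_iff {U : Finset (E × ℝ)} (hU : (sat U).Nonempty) {s : ℝ} {b : E} :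
    b ∈ reg s U ↔ ∀ β ∈ sat U, s ≤ ⟪b, β⟫ := by
  constructor
  · rintro ⟨w, hw, hs, rfl⟩ β hβ
    rw [sum_inner]
    refine hs.trans (Finset.sum_le_sum fun x hx => ?_)
    rw [real_inner_smul_left]
    exact mul_le_mul_of_nonneg_left (hβ x hx) (hw x hx)
  · intro h
    refine mem_reg_of_forall fun y τ hτ hy => ?_
    -- For `τ = 0`, `y` is a recession direction of `sat U`; a negative `⟪b, y⟫` would let `b` fall
    -- to `s - 1` along the ray from `β`.
    rcases hτ.eq_or_lt with rfl | hτ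
    · obtain ⟨β, hβ⟩ := hU
      have hk : ∀ k : ℝ, 0 ≤ k → s ≤ ⟪b, β⟫ + k * ⟪b, y⟫ := fun k hk => by
        have := h (β + k • y) fun x hx => by
          rw [inner_add_right, real_inner_smul_right]
          have h₁ := hy x hx
          rw [zero_mul] at h₁
          linarith [hβ x hx, mul_nonneg hk h₁]
        rwa [inner_add_right, real_inner_smul_right] at this
      rw [zero_mul]
      by_contra! hneg
      have h₀ := hk 0 le_rfl
      have h₁ := hk ((⟪b, β⟫ - s + 1) / -⟪b, y⟫) (div_nonneg (by linarith) (by linarith))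
      have h₂ : (⟪b, β⟫ - s + 1) / -⟪b, y⟫ * ⟪b, y⟫ = -(⟪b, β⟫ - s + 1) := by
        field_simp [hneg.ne]
      linarith
    · have := h (τ⁻¹ • y) fun x hx => by
        rw [real_inner_smul_right, ← div_eq_inv_mul, le_div_iff₀ hτ, mul_comm]
        exact hy x hx
      rwa [real_inner_smul_right, ← div_eq_inv_mul, le_div_iff₀ hτ, mul_comm] at this

/-! ### The polytope and its tangent cones -/

theorem mem_normalise {F : Type*} [NormedAddCommGroup F] {Ω : Finset (F × ℝ)} {x : F × ℝ} :
    x ∈ normalise Ω ↔ x = (0, -1) ∨ x ∈ Ω ∧ x ≠ (0, 0) := by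
  classical
  simp [normalise]

theorem finite_pointsP {F : Type*} (s : ℝ) (Ω : Finset (F × ℝ)) : (pointsP s Ω).Finite :=
  Ω.finite_toSet.preimage (f := fun v : F => (v, s)) fun _ _ _ _ h => congrArg Prod.fst h

/-- A linear functional bounded below on the three generating sets is bounded below on the
polytope. -/
theorem le_inner_of_mem_hullH {s m : ℝ} {p : ℕ} {Ω : Finset (E × ℝ)} {y : E}
    (h : ∀ v ∈ pointsP s Ω ∪ pointsZ s p Ω ∪ pointsN s p Ω, m ≤ ⟪v, y⟫) {x : E}
    (hx : x ∈ hullH s p Ω) : m ≤ ⟪x, y⟫ := by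
  have hconv : Convex ℝ {v : E | m ≤ ⟪v, y⟫} :=
    convex_halfSpace_ge ⟨fun a b => inner_add_left a b y, fun c a => real_inner_smul_left a y c⟩ m
  exact convexHull_min h hconv hx

/-- The constraints supporting points of `pointsP` cut out the intersection of the tangent cones of
the polytope at these points. -/
theorem exists_pos_mem_of_mem_sat {s : ℝ} {Ω L : Finset (E × ℝ)} {v x : E}
    (hv : v ∈ pointsP s Ω) (hvL : v ∈ sat L) (hx : x ∈ sat (supportingPart s Ω L)) :
    ∃ t : ℝ, 0 < t ∧ v + t • (x - v) ∈ sat L := by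
  classical
  have key : ∀ᶠ t : ℝ in nhdsWithin 0 (Set.Ioi 0),
      ∀ l ∈ L, l.2 ≤ ⟪l.1, v + t • (x - v)⟫ := by
    refine (Finset.eventually_all L).2 fun l hl => ?_
    -- Constraints tight at `v` hold at `x` too, hence along the segment; slack ones survive for
    -- small `t` by continuity.
    rcases (hvL l hl).eq_or_lt with heq | hlt
    · refine eventually_nhdsWithin_of_forall fun t (ht : 0 < t) => ?_
      rw [inner_add_right, real_inner_smul_right, ← heq, inner_sub_right, ← heq]
      have hlx : l.2 ≤ ⟪l.1, x⟫ := by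
        by_cases h0 : l.1 = 0
        · rw [heq, h0, inner_zero_left, inner_zero_left]
        · exact hx l (Finset.mem_filter.2 ⟨hl, v, hv, h0, heq.symm⟩)
      linarith [mul_nonneg ht.le (sub_nonneg.2 hlx)]
    · have hcont : Continuous fun t : ℝ => ⟪l.1, v + t • (x - v)⟫ := by fun_prop
      refine nhdsWithin_le_nhds ((hcont.tendsto 0).eventually ?_ |>.mono fun t ht => le_of_lt ht)
      exact lt_mem_nhds (by simpa using hlt)
  obtain ⟨t, ht, h₀⟩ := (key.and self_mem_nhdsWithin).exists
  exact ⟨t, h₀, ht⟩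

/-! ### Facet systems describe regions -/

theorem reg_subset_sat {s : ℝ} (hs : s = 1 ∨ s = -1) {p : ℕ} (hp : 1 < p) {Ω U : Finset (E × ℝ)}
    (hc : ∀ x ∈ Ω, x.2 = 1 ∨ x.2 = 0 ∨ x.2 = -1) (hU : IsFacetSystem s p Ω U) :
    reg s Ω ⊆ sat U := by
  classical
  obtain ⟨L, ⟨hL, -⟩, rfl⟩ := hU
  rintro _ ⟨w, hw, hsum, rfl⟩ ⟨n, r⟩ hn
  obtain ⟨hnL, v, hv, -, hnv⟩ := Finset.mem_filter.1 hn
  dsimp only at hnv ⊢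
  have hp' : (0 : ℝ) < (p : ℝ) - 1 := sub_pos.2 (by exact_mod_cast hp)
  have hH : ∀ u ∈ pointsP s (normalise Ω) ∪ pointsZ s p (normalise Ω) ∪
      pointsN s p (normalise Ω), r ≤ ⟪n, u⟫ := fun u hu => by
    have : u ∈ sat L := hL ▸ subset_convexHull ℝ _ hu
    exact this _ hnL
  have hP : ∀ α, (α, s) ∈ normalise Ω → r ≤ ⟪n, α⟫ := fun α hα => hH α (.inl (.inl hα))
  have hZ : ∀ α, (α, (0 : ℝ)) ∈ normalise Ω → 0 ≤ ⟪n, α⟫ := fun α hα => by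
    have := hH _ (.inl (.inr ⟨v, α, hv, hα, rfl⟩))
    rw [inner_add_right, real_inner_smul_right, hnv] at this
    exact nonneg_of_mul_nonneg_right (by linarith) hp'
  have hN : ∀ α, (α, -s) ∈ normalise Ω → -r ≤ ⟪n, α⟫ := fun α hα => by
    have := hH _ (.inr ⟨v, α, hv, hα, rfl⟩)
    rw [inner_add_right, real_inner_smul_right, real_inner_smul_right, hnv] at this
    have : 0 ≤ ((p : ℝ) - 1) * (r + ⟪n, α⟫) := by linarith
    linarith [nonneg_of_mul_nonneg_right this hp']
  have h₀ : ((0 : E), (-1 : ℝ)) ∈ normalise Ω := mem_normalise.2 (.inl rfl)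
  have hbound : ∀ x ∈ Ω, s * r * x.2 ≤ ⟪n, x.1⟫ := by
    rintro ⟨α, c⟩ hx
    by_cases hx0 : (α, c) = ((0 : E), (0 : ℝ))
    · rw [Prod.mk.injEq] at hx0
      simp [hx0.1, hx0.2]
    · have hmem : (α, c) ∈ normalise Ω := mem_normalise.2 (.inr ⟨hx, hx0⟩)
      have hcx : c = 1 ∨ c = 0 ∨ c = -1 := hc _ hx
      dsimp only
      rcases hs with rfl | rfl <;> rcases hcx with rfl | rfl | rfl
      · linarith [hP α hmem]
      · linarith [hZ α hmem]
      · linarith [hN α hmem]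
      · linarith [hN α (by simpa using hmem)]
      · linarith [hZ α hmem]
      · linarith [hP α hmem]
  -- The adjoined constraint `(0, -1)` fixes the sign of `r`.
  have hsr : 0 ≤ s * r := by
    rcases hs with rfl | rfl
    · have := hN 0 h₀
      rw [inner_zero_right] at this
      linarith
    · have := hP 0 h₀
      rw [inner_zero_right] at this
      linarith
  have hss : s * s = 1 := by rcases hs with rfl | rfl <;> norm_num
  calc r = s * r * s := by linear_combination (-r) * hss
    _ ≤ s * r * ∑ x ∈ Ω, w x * x.2 := mul_le_mul_of_nonneg_left hsum hsr
    _ = ∑ x ∈ Ω, w x * (s * r * x.2) := by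
      rw [Finset.mul_sum]
      exact Finset.sum_congr rfl fun x _ => by ring
    _ ≤ ∑ x ∈ Ω, w x * ⟪n, x.1⟫ :=
      Finset.sum_le_sum fun x hx => mul_le_mul_of_nonneg_left (hbound x hx) (hw x hx)
    _ = ⟪n, ∑ x ∈ Ω, w x • x.1⟫ := by
      rw [inner_sum]
      exact Finset.sum_congr rfl fun x _ => (real_inner_smul_right _ _ _).symm

theorem sat_subset_reg {s : ℝ} {p : ℕ} (hp : 1 < p) {Ω U : Finset (E × ℝ)}
    (hne : (pointsP s (normalise Ω)).Nonempty) (hU : IsFacetSystem s p Ω U) :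
    sat U ⊆ reg s Ω := by
  obtain ⟨L, ⟨hL, -⟩, rfl⟩ := hU
  intro x hx
  refine mem_reg_of_forall fun y τ hτ hy => ?_
  have hp' : (0 : ℝ) < (p : ℝ) - 1 := sub_pos.2 (by exact_mod_cast hp)
  have hy' : ∀ z ∈ normalise Ω, τ * z.2 ≤ ⟪z.1, y⟫ := fun z hz => by
    rcases mem_normalise.1 hz with rfl | ⟨hz, -⟩
    · simpa using hτ
    · exact hy z hz
  obtain ⟨v, hv, hmin⟩ := (finite_pointsP s (normalise Ω)).exists_minimalFor
    (fun v => ⟪v, y⟫) _ hne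
  have hmin' : ∀ u ∈ pointsP s (normalise Ω), ⟪v, y⟫ ≤ ⟪u, y⟫ := fun u hu =>
    (le_total ⟪v, y⟫ ⟪u, y⟫).elim id fun h => hmin hu h
  have hvH : v ∈ sat L := hL ▸ subset_convexHull ℝ _ (.inl (.inl hv))
  obtain ⟨t, ht, hmem⟩ := exists_pos_mem_of_mem_sat hv hvH hx
  rw [hL] at hmem
  -- `v` minimises over the whole polytope: a Z point is `α + (p - 1) • β` with `⟪β, y⟫ ≥ 0`, an N
  -- point is `α + (p - 1) • (α + β)` with `⟪α + β, y⟫ ≥ 0`.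
  have hle : ⟪v, y⟫ ≤ ⟪v + t • (x - v), y⟫ := by
    refine le_inner_of_mem_hullH ?_ hmem
    rintro u ((hu | ⟨α, β, hα, hβ, rfl⟩) | ⟨α, β, hα, hβ, rfl⟩)
    · exact hmin' u hu
    · have h₁ : 0 ≤ ⟪β, y⟫ := by simpa using hy' _ hβ
      rw [inner_add_left, real_inner_smul_left]
      linarith [hmin' α hα, mul_nonneg hp'.le h₁]
    · have h₁ : τ * s ≤ ⟪α, y⟫ := hy' _ hα
      have h₂ : τ * -s ≤ ⟪β, y⟫ := hy' _ hβ
      rw [inner_add_left, real_inner_smul_left, real_inner_smul_left]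
      have h₃ : 0 ≤ ((p : ℝ) - 1) * (⟪α, y⟫ + ⟪β, y⟫) := mul_nonneg hp'.le (by linarith)
      linarith [hmin' α hα]
  rw [inner_add_left, real_inner_smul_left, inner_sub_left] at hle
  have h₁ : 0 ≤ ⟪x, y⟫ - ⟪v, y⟫ := nonneg_of_mul_nonneg_right (by linarith) ht
  have h₂ : τ * s ≤ ⟪v, y⟫ := hy' _ hv
  linarith

/-! ### Recovering Ω from its regions -/

theorem smul_mem_reg {Ω : Finset (E × ℝ)} {α : E} {c s k : ℝ} (h : (α, c) ∈ Ω) (hk : 0 ≤ k)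
    (hs : s ≤ k * c) : k • α ∈ reg s Ω := by
  classical
  refine ⟨fun x => if x = (α, c) then k else 0, fun x _ => ?_, ?_, ?_⟩
  · dsimp only
    split_ifs
    exacts [hk, le_rfl]
  · simpa [ite_mul, h] using hs
  · simp [ite_smul, h]

theorem le_inner_of_mem_sat_of_mem_reg {Ω : Finset (E × ℝ)} {b β : E} {s : ℝ} (hb : b ∈ sat Ω)
    (hβ : β ∈ reg s Ω) : s ≤ ⟪b, β⟫ := by
  rw [real_inner_comm]
  exact (mem_reg_iff ⟨b, hb⟩).1 hβ b hb

theorem zero_mem_reg_neg_one (Ω : Finset (E × ℝ)) : (0 : E) ∈ reg (-1) Ω :=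
  ⟨0, fun _ _ => le_rfl, by simp, by simp⟩

theorem zero_le_inner_of_forall_mem_reg {Ω : Finset (E × ℝ)} {b α : E} (h : (α, (0 : ℝ)) ∈ Ω)
    (hb : ∀ β ∈ reg (-1) Ω, -1 ≤ ⟪b, β⟫) : 0 ≤ ⟪α, b⟫ := by
  by_contra! hneg
  -- Every nonnegative multiple of `α` lies in the region; this one has inner product `-2 < -1` with
  -- `b`.
  have h₁ := hb _ (smul_mem_reg h (k := 2 / -⟪α, b⟫) (div_nonneg zero_le_two (by linarith))
    (by simp))
  rw [real_inner_smul_right, real_inner_comm α b] at h₁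
  have h₂ : 2 / -⟪α, b⟫ * ⟪α, b⟫ = -2 := by field_simp [hneg.ne]
  linarith

theorem neg_one_le_inner_of_forall_mem_reg {Ω : Finset (E × ℝ)} {b α : E}
    (h : (α, (-1 : ℝ)) ∈ Ω) (hb : ∀ β ∈ reg (-1) Ω, -1 ≤ ⟪b, β⟫) : -1 ≤ ⟪α, b⟫ := by
  have := hb _ (smul_mem_reg h zero_le_one (by simp))
  rwa [one_smul, real_inner_comm] at this

theorem sat_eq_reg {s : ℝ} (hs : s = 1 ∨ s = -1) {p : ℕ} (hp : 1 < p) {Ω U : Finset (E × ℝ)}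
    (hc : ∀ x ∈ Ω, x.2 = 1 ∨ x.2 = 0 ∨ x.2 = -1)
    (hne : (pointsP s (normalise Ω)).Nonempty) (hU : IsFacetSystem s p Ω U) :
    sat U = reg s Ω :=
  (sat_subset_reg hp hne hU).antisymm (reg_subset_sat hs hp hc hU)

theorem pointsP_neg_one_normalise_nonempty {F : Type*} [NormedAddCommGroup F]
    (Ω : Finset (F × ℝ)) :
    (pointsP (-1) (normalise Ω)).Nonempty :=
  ⟨0, mem_normalise.2 (.inl rfl)⟩

end LinearConstraints

open LinearConstraints in
theorem mainTheorem10 {E : Type*} [NormedAddCommGroup E] [InnerProductSpace ℝ E]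
    [FiniteDimensional ℝ E] (Ω : Finset (E × ℝ))
    (hc : ∀ x ∈ Ω, x.2 = 1 ∨ x.2 = 0 ∨ x.2 = -1)
    (hΩ : (sat Ω).Nonempty)
    (p q : ℕ) (hp : 1 < p) (hq : 1 < q) :
    ((∃ α : E, (α, (1 : ℝ)) ∈ Ω) →
      ∀ Uplus Uminus : Finset (E × ℝ),
        IsFacetSystem 1 p Ω Uplus → IsFacetSystem (-1) q Ω Uminus →
        sat Uplus = reg 1 Ω ∧ sat Uminus = reg (-1) Ω ∧
          sat Ω = reg 1 Uplus ∩ reg (-1) Uminus) ∧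
    ((¬ ∃ α : E, (α, (1 : ℝ)) ∈ Ω) →
      ∀ Uminus : Finset (E × ℝ), IsFacetSystem (-1) q Ω Uminus →
        sat Uminus = reg (-1) Ω ∧ sat Ω = reg (-1) Uminus) := by
  have hminus : ∀ U : Finset (E × ℝ), IsFacetSystem (-1) q Ω U → sat U = reg (-1) Ω := fun U hU =>
    sat_eq_reg (.inr rfl) hq hc (pointsP_neg_one_normalise_nonempty Ω) hU
  have hreg : ∀ U : Finset (E × ℝ), sat U = reg (-1) Ω → ∀ b : E,
      b ∈ reg (-1) U ↔ ∀ β ∈ reg (-1) Ω, -1 ≤ ⟪b, β⟫ := fun U hU b => by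
    rw [mem_reg_iff (hU ▸ ⟨0, zero_mem_reg_neg_one Ω⟩), hU]
  constructor
  · rintro ⟨α, hα⟩ Uplus Uminus hUp hUm
    have hP : sat Uplus = reg 1 Ω :=
      sat_eq_reg (.inl rfl) hp hc ⟨α, mem_normalise.2 (.inr ⟨hα, by simp⟩)⟩ hUp
    have hM := hminus Uminus hUm
    have hαmem : ∀ v : E, (v, (1 : ℝ)) ∈ Ω → v ∈ reg 1 Ω := fun v hv => by
      simpa using smul_mem_reg hv zero_le_one (s := 1) (by simp)
    refine ⟨hP, hM, Set.ext fun b => ?_⟩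
    rw [Set.mem_inter_iff, hreg _ hM, mem_reg_iff (hP ▸ ⟨α, hαmem α hα⟩), hP]
    refine ⟨fun hb => ⟨fun β => le_inner_of_mem_sat_of_mem_reg hb,
      fun β => le_inner_of_mem_sat_of_mem_reg hb⟩, ?_⟩
    rintro ⟨h₁, h₂⟩ ⟨v, c⟩ hv
    obtain rfl | rfl | rfl : c = 1 ∨ c = 0 ∨ c = -1 := hc _ hv
    · rw [real_inner_comm]
      exact h₁ v (hαmem v hv)
    · exact zero_le_inner_of_forall_mem_reg hv h₂
    · exact neg_one_le_inner_of_forall_mem_reg hv h₂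
  · intro hnone U hU
    have hM := hminus U hU
    refine ⟨hM, Set.ext fun b => ?_⟩
    rw [hreg _ hM]
    refine ⟨fun hb β => le_inner_of_mem_sat_of_mem_reg hb, ?_⟩
    rintro h ⟨v, c⟩ hv
    obtain rfl | rfl | rfl : c = 1 ∨ c = 0 ∨ c = -1 := hc _ hv
    · exact absurd ⟨v, hv⟩ hnone
    · exact zero_le_inner_of_forall_mem_reg hv h
    · exact neg_one_le_inner_of_forall_mem_reg hv h
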